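/- **Definitions.** Let HTop be the category of topological spaces and homotopy classes of continuous maps, and HPol its full subcategory on the spaces having the homotopy type of a polyhedron (the realization of a simplicial complex with the weak topology). An inverse system $\mathbf X=(X_\lambda,p_{\lambda\lambda'},\Lambda)$ is indexed by a nonempty directed preordered set. An $S^*$-morphism $(f,f^n_\mu):\mathbf X\to\mathbf Y=(Y_\mu,q_{\mu\mu'},M)$ is a function $f:M\to\Lambda$ with morphisms $f^n_\mu:X_{f(\mu)}\to Y_\mu$ ($n\in\mathbb N$, $\mu\in M$) such that for all $\mu\le\mu'$ there are $\lambda\ge f(\mu),f(\mu')$ and $n$ with $q_{\mu\mu'}f^{n'}_{\mu'}p_{f(\mu')\lambda}=f^{n'}_\mu p_{f(\mu)\lambda}$ for all $n'\ge n$. Two $S^*$-morphisms $(f,f^n_\mu)$, $(g,g^n_\mu)$ are equivalent if for every $\mu$ there are $\lambda\ge f(\mu),g(\mu)$ and $n$ with $f^{n'}_\mu p_{f(\mu)\lambda}=g^{n'}_\mu p_{g(\mu)\lambda}$ for all $n'\ge n$. Equivalence classes are the morphisms of pro$^*$-HPol; composition is $(g,g^n_\nu)(f,f^n_\mu)=(fg,\,g^n_\nu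 f^n_{g(\nu)})$. An HPol-expansion of a space $X$ is an inverse system $\mathbf X$ in HPol with morphisms $p_\lambda:X\to X_\lambda$ in HTop, $p_{\lambda\lambda'}p_{\lambda'}=p_\lambda$, such that for every $P$ in HPol: (E1) every $h:X\to P$ equals $fp_\lambda$ for some $\lambda$ and $f:X_\lambda\to P$; (E2) if $f_0,f_1:X_\lambda\to P$ satisfy $f_0p_\lambda=f_1p_\lambda$, then $f_0p_{\lambda\lambda'}=f_1p_{\lambda\lambda'}$ for some $\lambda'\ge\lambda$. Every space has an HPol-expansion, and any two expansions of the same space are canonically isomorphic. A coarse shape morphism $X\to Y$ is a class of pro$^*$-HPol morphisms $\mathbf X\to\mathbf Y$ between expansions of $X$ and $Y$, where morphisms are identified if they correspond under the canonical isomorphisms of expansions. These form the set $Sh^*(X,Y)$; composition and identities $1^*_X$ are defined through representatives, which gives the coarse shape category. For an HPol-expansion $(p_\lambda)$ of $Y$, the topology on $Sh^*(X,Y)$ has as basis the sets $V^F_\lambda=\{G\in Sh^*(X,Y): p_\lambda\circ F=p_\lambda\circ G\}$, $F\in Sh^*(X,Y)$, $\lambda\in\Lambda$, where $p_\lambda$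 is regarded as a coarse shape morphism $Y\to Y_\lambda$. It does not depend on the expansion. For $F\in Sh^*(X,Y)$ and a space $Z$ let $F_1:Sh^*(Y,Z)\to Sh^*(X,Z)$, $F_1(H)=H\circ F$, and $F_2:Sh^*(Z,X)\to Sh^*(Z,Y)$, $F_2(G)=F\circ G$. Write $Sh^*(X)\ge Sh^*(Y)$ if there are $F\in Sh^*(X,Y)$ and $G\in Sh^*(Y,X)$ with $F\circ G=1^*_Y$, and $Sh^*(X)=Sh^*(Y)$ if $F,G$ can be chosen with also $G\circ F=1^*_X$. **Theorem.** Let $X,Y,Z$ be arbitrary topological spaces. The composition map $$\Omega:Sh^*(X,Y)\times Sh^*(Y,Z)\to Sh^*(X,Z),\qquad \Omega(F,G)=G\circ F,$$ is continuous. Moreover: 1. For every $F\in Sh^*(X,Y)$ the maps $F_1$ and $F_2$ (taken with respect to $Z$) are continuous. For every space $W$ and $G\in Sh^*(Y,W)$, $(G\circ F)_2=G_2\circ F_2$ and $(G\circ F)_1=F_1\circ G_1$. The maps $(1^*_X)_1$ and $(1^*_X)_2$ are identity maps. 2. If $Sh^*(X)\ge Sh^*(Y)$, then $Sh^*(Y,Z)$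 is homeomorphic to a retract of $Sh^*(X,Z)$, and $Sh^*(Z,Y)$ is homeomorphic to a retract of $Sh^*(Z,X)$. 3. If $Sh^*(X)=Sh^*(Y)$, then $Sh^*(Y,Z)$ is homeomorphic to $Sh^*(X,Z)$, and $Sh^*(Z,Y)$ is homeomorphic to $Sh^*(Z,X)$. -/

import Mathlib

open CategoryTheory

/-! ## Pro-categories and coarse pro-categories -/

section ProStar

universe w v u

/- Makes `X ⟶ Y` elaborate through the category structure directly. -/
attribute [local instance 2000] CategoryStruct.toQuiver

/-- An inverse system `(X_a, p_{ab}, A)` in a category, over a nonempty directed preordered set. -/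
structure InvSystem (C : Type u) [Category.{v} C] where
  Idx : Type w
  [preorder : Preorder Idx]
  [directed : IsDirectedOrder Idx]
  [nonempty : Nonempty Idx]
  obj : Idx → C
  /-- the bonding morphism `p_{ab} : X_b ⟶ X_a` for `a ≤ b` -/
  bond : ∀ {a b : Idx}, a ≤ b → (obj b ⟶ obj a)
  bond_refl : ∀ a : Idx, bond (le_refl a) = 𝟙 (obj a)
  bond_comp : ∀ {a b c : Idx} (h : a ≤ b) (k : b ≤ c), bond k ≫ bond h = bond (h.trans k)

attribute [instance] InvSystem.preorder InvSystem.directed InvSystem.nonempty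
attribute [simp] InvSystem.bond_refl InvSystem.bond_comp

namespace InvSystem

variable {C : Type u} [Category.{v} C]

@[simp] theorem bond_comp_assoc (X : InvSystem.{w} C) {a b c : X.Idx} (h : a ≤ b) (k : b ≤ c)
    {Z : C} (f : X.obj a ⟶ Z) : X.bond k ≫ X.bond h ≫ f = X.bond (h.trans k) ≫ f := by
  rw [← Category.assoc, bond_comp]

/-- The rudimentary system consisting of a single object. -/
abbrev rudimentary (X : C) : InvSystem.{w} C where
  Idx := PUnit
  obj _ := X
  bond _ := 𝟙 X
  bond_refl _ := rfl
  bond_comp _ _ := Category.id_comp _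

end InvSystem

variable {C : Type u} [Category.{v} C]

/-- A morphism of inverse systems: an index function and a family of morphisms
`f_m : X_{f(m)} ⟶ Y_m`; its equivalence classes are the morphisms of the pro-category. -/
structure SysMor (X Y : InvSystem.{w} C) where
  idx : Y.Idx → X.Idx
  hom : ∀ m : Y.Idx, X.obj (idx m) ⟶ Y.obj m
  comm : ∀ {m m' : Y.Idx} (h : m ≤ m'), ∃ (l : X.Idx) (h₁ : idx m ≤ l) (h₂ : idx m' ≤ l),
    X.bond h₂ ≫ hom m' ≫ Y.bond h = X.bond h₁ ≫ hom m

/-- An `S*`-morphism of inverse systems: an index function and, for each `n`, a family of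
morphisms `f^n_m : X_{f(m)} ⟶ Y_m`, which commute with the bonding morphisms for large `n`. -/
structure SStarMor (X Y : InvSystem.{w} C) where
  idx : Y.Idx → X.Idx
  hom : ∀ (_ : ℕ) (m : Y.Idx), X.obj (idx m) ⟶ Y.obj m
  comm : ∀ {m m' : Y.Idx} (h : m ≤ m'),
    ∃ (l : X.Idx) (h₁ : idx m ≤ l) (h₂ : idx m' ≤ l) (n : ℕ), ∀ n' : ℕ, n ≤ n' →
      X.bond h₂ ≫ hom n' m' ≫ Y.bond h = X.bond h₁ ≫ hom n' m

namespace SStarMor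

/-- Equivalence of `S*`-morphisms. -/
def Equiv {X Y : InvSystem.{w} C} (f g : SStarMor X Y) : Prop :=
  ∀ m : Y.Idx, ∃ (l : X.Idx) (h₁ : f.idx m ≤ l) (h₂ : g.idx m ≤ l) (n : ℕ), ∀ n' : ℕ, n ≤ n' →
    X.bond h₁ ≫ f.hom n' m = X.bond h₂ ≫ g.hom n' m

theorem Equiv.refl {X Y : InvSystem.{w} C} (f : SStarMor X Y) : f.Equiv f :=
  fun m => ⟨f.idx m, le_rfl, le_rfl, 0, fun _ _ => rfl⟩

theorem Equiv.symm {X Y : InvSystem.{w} C} {f g : SStarMor X Y} (h : f.Equiv g) : g.Equiv f := by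
  intro m
  obtain ⟨l, h₁, h₂, n, e⟩ := h m
  exact ⟨l, h₂, h₁, n, fun n' hn => (e n' hn).symm⟩

theorem bond_congr {X : InvSystem.{w} C} {a b l k : X.Idx} {h₁ : a ≤ l} {h₂ : b ≤ l} {Z : C}
    {f : X.obj a ⟶ Z} {g : X.obj b ⟶ Z} (e : X.bond h₁ ≫ f = X.bond h₂ ≫ g) (hk : l ≤ k) :
    X.bond (h₁.trans hk) ≫ f = X.bond (h₂.trans hk) ≫ g := by
  rw [← X.bond_comp_assoc h₁ hk, e, X.bond_comp_assoc]

theorem Equiv.trans {X Y : InvSystem.{w} C} {f g k : SStarMor X Y} (h : f.Equiv g)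
    (h' : g.Equiv k) : f.Equiv k := by
  intro m
  obtain ⟨l, h₁, h₂, n, e⟩ := h m
  obtain ⟨l', h₁', h₂', n', e'⟩ := h' m
  obtain ⟨L, hl, hl'⟩ := exists_ge_ge l l'
  refine ⟨L, h₁.trans hl, h₂'.trans hl', max n n', fun i hi => ?_⟩
  rw [bond_congr (e i (le_trans (le_max_left _ _) hi)) hl,
    ← bond_congr (e' i (le_trans (le_max_right _ _) hi)) hl']

instance setoid (X Y : InvSystem.{w} C) : Setoid (SStarMor X Y) where
  r := Equiv
  iseqv := ⟨Equiv.refl, Equiv.symm, Equiv.trans⟩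

/-- The identity `S*`-morphism. -/
def id (X : InvSystem.{w} C) : SStarMor X X where
  idx a := a
  hom _ a := 𝟙 (X.obj a)
  comm {_ m'} h := ⟨m', h, le_rfl, 0, fun _ _ => by simp⟩

/-- Composition of `S*`-morphisms (in diagrammatic order). -/
def comp {X Y Z : InvSystem.{w} C} (f : SStarMor X Y) (g : SStarMor Y Z) : SStarMor X Z where
  idx m := f.idx (g.idx m)
  hom n m := f.hom n (g.idx m) ≫ g.hom n m
  comm {m m'} h := by
    obtain ⟨l, h₁, h₂, n, e⟩ := g.comm h
    obtain ⟨a, a₁, a₂, i, ea⟩ := f.comm h₁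
    obtain ⟨b, b₁, b₂, j, eb⟩ := f.comm h₂
    obtain ⟨c, hac, hbc⟩ := exists_ge_ge a b
    refine ⟨c, a₁.trans hac, b₁.trans hbc, max n (max i j), fun k hk => ?_⟩
    have e' := e k (by omega)
    have ea' := bond_congr (by simpa using ea k (by omega)) hac (h₁ := a₂) (h₂ := a₁)
      (f := f.hom k l ≫ Y.bond h₁)
    have eb' := bond_congr (by simpa using eb k (by omega)) hbc (h₁ := b₂) (h₂ := b₁)
      (f := f.hom k l ≫ Y.bond h₂)
    calc X.bond (b₁.trans hbc) ≫ (f.hom k (g.idx m') ≫ g.hom k m') ≫ Z.bond h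
        = (X.bond (b₁.trans hbc) ≫ f.hom k (g.idx m')) ≫ g.hom k m' ≫ Z.bond h := by simp
      _ = X.bond (b₂.trans hbc) ≫ f.hom k l ≫ Y.bond h₂ ≫ g.hom k m' ≫ Z.bond h := by
          rw [← eb']; simp
      _ = (X.bond (a₂.trans hac) ≫ f.hom k l ≫ Y.bond h₁) ≫ g.hom k m := by
          rw [e']; simp
      _ = _ := by rw [ea']; simp

theorem comp_congr {X Y Z : InvSystem.{w} C} {f f' : SStarMor X Y} {g g' : SStarMor Y Z}
    (hf : f.Equiv f') (hg : g.Equiv g') : (f.comp g).Equiv (f'.comp g') := by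
  intro m
  obtain ⟨l, h₁, h₂, n, e⟩ := hg m
  obtain ⟨a, a₁, a₂, i, ea⟩ := f.comm h₁
  obtain ⟨b, b₁, b₂, j, eb⟩ := f'.comm h₂
  obtain ⟨c, c₁, c₂, k, ec⟩ := hf l
  obtain ⟨d, had, hbd⟩ := exists_ge_ge a b
  obtain ⟨L, hdL, hcL⟩ := exists_ge_ge d c
  refine ⟨L, a₁.trans (had.trans hdL), b₁.trans (hbd.trans hdL), max (max n i) (max j k),
    fun t ht => ?_⟩
  have e' := e t (by omega)
  have ea' := bond_congr (by simpa using ea t (by omega)) (had.trans hdL) (h₁ := a₂) (h₂ := a₁)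
    (f := f.hom t l ≫ Y.bond h₁)
  have eb' := bond_congr (by simpa using eb t (by omega)) (hbd.trans hdL) (h₁ := b₂) (h₂ := b₁)
    (f := f'.hom t l ≫ Y.bond h₂)
  have ec' := bond_congr (ec t (by omega)) hcL
  change X.bond _ ≫ f.hom t _ ≫ g.hom t m = X.bond _ ≫ f'.hom t _ ≫ g'.hom t m
  calc X.bond (a₁.trans (had.trans hdL)) ≫ f.hom t (g.idx m) ≫ g.hom t m
      = (X.bond (c₁.trans hcL) ≫ f.hom t l) ≫ Y.bond h₁ ≫ g.hom t m := by
        rw [← Category.assoc, ← ea']; simp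
    _ = (X.bond (c₂.trans hcL) ≫ f'.hom t l) ≫ Y.bond h₂ ≫ g'.hom t m := by rw [e', ec']
    _ = (X.bond (b₂.trans (hbd.trans hdL)) ≫ f'.hom t l ≫ Y.bond h₂) ≫ g'.hom t m := by simp
    _ = _ := by rw [eb']; simp

end SStarMor

/-- The category pro*-`C`: objects are inverse systems, morphisms are equivalence classes of
`S*`-morphisms. -/
instance InvSystem.category : Category (InvSystem.{w} C) where
  Hom X Y := Quotient (SStarMor.setoid X Y)
  id X := ⟦SStarMor.id X⟧
  comp := Quotient.map₂ SStarMor.comp fun _ _ hf _ _ hg => SStarMor.comp_congr hf hg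
  id_comp := by
    rintro X Y ⟨f⟩
    exact Quotient.sound fun m => ⟨f.idx m, le_rfl, le_rfl, 0, fun _ _ => by
      simp [SStarMor.comp, SStarMor.id]⟩
  comp_id := by
    rintro X Y ⟨f⟩
    exact Quotient.sound fun m => ⟨f.idx m, le_rfl, le_rfl, 0, fun _ _ => by
      simp [SStarMor.comp, SStarMor.id]⟩
  assoc := by
    rintro X Y Z W ⟨f⟩ ⟨g⟩ ⟨k⟩
    exact Quotient.sound fun m => ⟨_, le_rfl, le_rfl, 0, fun _ _ => by
      simp [SStarMor.comp]⟩

/-- The pro*-morphism represented by an `S*`-morphism. -/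
def SStarMor.toPro {X Y : InvSystem.{w} C} (f : SStarMor X Y) : X ⟶ Y :=
  Quotient.mk (SStarMor.setoid X Y) f

/-- The functor from the pro-category to the pro*-category, on representatives: the constant
sequence `f^n_m = f_m`. -/
def SysMor.toStar {X Y : InvSystem.{w} C} (f : SysMor X Y) : SStarMor X Y where
  idx := f.idx
  hom _ m := f.hom m
  comm h := by
    obtain ⟨l, h₁, h₂, e⟩ := f.comm h
    exact ⟨l, h₁, h₂, 0, fun _ _ => e⟩

/-- The pro*-morphism induced by a morphism of inverse systems. -/
def SysMor.toPro {X Y : InvSystem.{w} C} (f : SysMor X Y) : X ⟶ Y := f.toStar.toPro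

/-! ## Expansions -/

/-- A `P`-expansion of `X`, for the full subcategory of `C` on the objects satisfying `P`:
a morphism `p = (p_a) : X ⟶ (X_a, p_{ab}, A)` of the pro-category into a system of objects of `P`
with properties (E1) and (E2). -/
structure Expansion (P : ObjectProperty C) (X : C) where
  sys : InvSystem.{w} C
  mem : ∀ a, P (sys.obj a)
  proj : ∀ a, X ⟶ sys.obj a
  proj_bond : ∀ {a b : sys.Idx} (h : a ≤ b), proj b ≫ sys.bond h = proj a
  E1 : ∀ (Q : C), P Q → ∀ h : X ⟶ Q, ∃ (a : sys.Idx) (f : sys.obj a ⟶ Q), proj a ≫ f = h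
  E2 : ∀ (Q : C), P Q → ∀ (a : sys.Idx) (f₀ f₁ : sys.obj a ⟶ Q), proj a ≫ f₀ = proj a ≫ f₁ →
    ∃ (b : sys.Idx) (h : a ≤ b), sys.bond h ≫ f₀ = sys.bond h ≫ f₁

namespace Expansion

attribute [simp] proj_bond

variable {P : ObjectProperty C} {X Y Z : C}

@[simp] theorem proj_bond_assoc (p : Expansion.{w} P X) {a b : p.sys.Idx} (h : a ≤ b) {Q : C}
    (f : p.sys.obj a ⟶ Q) : p.proj b ≫ p.sys.bond h ≫ f = p.proj a ≫ f := by
  rw [← Category.assoc, proj_bond]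

/-- The morphism of systems `i` satisfies `i ∘ p = p'`. -/
def Compat (p p' : Expansion.{w} P X) (i : SysMor p.sys p'.sys) : Prop :=
  ∀ m, p.proj (i.idx m) ≫ i.hom m = p'.proj m

theorem exists_compat (p p' : Expansion.{w} P X) : ∃ i, Compat p p' i := by
  choose φ f hf using fun m => p.E1 _ (p'.mem m) (p'.proj m)
  refine ⟨⟨φ, f, fun {m m'} h => ?_⟩, hf⟩
  obtain ⟨l, h₁, h₂⟩ := exists_ge_ge (φ m) (φ m')
  obtain ⟨b, hb, e⟩ := p.E2 _ (p'.mem m) l (p.sys.bond h₂ ≫ f m' ≫ p'.sys.bond h)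
    (p.sys.bond h₁ ≫ f m) (by simp [← Category.assoc, hf])
  exact ⟨b, h₁.trans hb, h₂.trans hb, by simpa using e⟩

theorem Compat.unique {p p' : Expansion.{w} P X} {i j : SysMor p.sys p'.sys}
    (hi : Compat p p' i) (hj : Compat p p' j) : i.toPro = j.toPro := by
  refine Quotient.sound fun m => ?_
  obtain ⟨l, h₁, h₂⟩ := exists_ge_ge (i.idx m) (j.idx m)
  obtain ⟨b, hb, e⟩ := p.E2 _ (p'.mem m) l (p.sys.bond h₁ ≫ i.hom m)
    (p.sys.bond h₂ ≫ j.hom m) (by simp [hi m, hj m])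
  exact ⟨b, h₁.trans hb, h₂.trans hb, 0, fun _ _ => by simpa [SysMor.toStar] using e⟩

/-- The image in pro*-`C` of the unique morphism `i` of pro-`C` between two expansions of the same
object with `i ∘ p = p'`. -/
noncomputable def can (p p' : Expansion.{w} P X) : p.sys ⟶ p'.sys :=
  (exists_compat p p').choose.toPro

theorem can_eq {p p' : Expansion.{w} P X} {i : SysMor p.sys p'.sys} (h : Compat p p' i) :
    can p p' = i.toPro :=
  Compat.unique (exists_compat p p').choose_spec h

@[simp] theorem can_self (p : Expansion.{w} P X) : can p p = 𝟙 p.sys :=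
  can_eq (i := ⟨fun a => a, fun a => 𝟙 _, fun {_ m'} h => ⟨m', h, le_rfl, by simp⟩⟩)
    fun m => by simp

@[simp] theorem can_trans (p p' p'' : Expansion.{w} P X) :
    can p p' ≫ can p' p'' = can p p'' := by
  obtain ⟨i, hi⟩ := exists_compat p p'
  obtain ⟨j, hj⟩ := exists_compat p' p''
  obtain ⟨k, hk⟩ := exists_compat p p''
  rw [can_eq hi, can_eq hj, can_eq hk]
  refine Quotient.sound fun m => ?_
  obtain ⟨l, h₁, h₂⟩ := exists_ge_ge (i.idx (j.idx m)) (k.idx m)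
  obtain ⟨b, hb, e⟩ := p.E2 _ (p''.mem m) l (p.sys.bond h₁ ≫ i.hom (j.idx m) ≫ j.hom m)
    (p.sys.bond h₂ ≫ k.hom m) (by
      rw [proj_bond_assoc, proj_bond_assoc, hk m, ← hj m, ← hi (j.idx m), Category.assoc])
  exact ⟨b, h₁.trans hb, h₂.trans hb, 0, fun _ _ => by
    simpa [SStarMor.comp, SysMor.toStar] using e⟩

@[simp] theorem can_trans_assoc (p p' p'' : Expansion.{w} P X) {W : InvSystem.{w} C}
    (f : p''.sys ⟶ W) : can p p' ≫ can p' p'' ≫ f = can p p'' ≫ f := by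
  rw [← Category.assoc, can_trans]

/-- An object of the subcategory is its own (rudimentary) expansion. -/
abbrev rudimentary (Q : C) (hQ : P Q) : Expansion.{w} P Q where
  sys := InvSystem.rudimentary Q
  mem _ := hQ
  proj _ := 𝟙 Q
  proj_bond _ := Category.id_comp _
  E1 _ _ h := ⟨PUnit.unit, h, Category.id_comp _⟩
  E2 _ _ a f₀ f₁ h := ⟨a, le_rfl, by simpa [InvSystem.rudimentary] using h⟩

end Expansion

/-! ## Coarse shape morphisms -/

/-- A representative of a coarse shape morphism `X → Y`: a pro*-morphism between an expansion
of `X` and an expansion of `Y`. -/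
structure CoarseRep (P : ObjectProperty C) (X Y : C) where
  src : Expansion.{w} P X
  tgt : Expansion.{w} P Y
  hom : src.sys ⟶ tgt.sys

/-- The pro*-`P` equivalence of representatives: the square formed by the two pro*-morphisms and
the canonical isomorphisms of expansions commutes. -/
instance CoarseRep.setoid (P : ObjectProperty C) (X Y : C) : Setoid (CoarseRep.{w} P X Y) where
  r F G := F.hom ≫ Expansion.can F.tgt G.tgt = Expansion.can F.src G.src ≫ G.hom
  iseqv := by
    refine ⟨fun F => by simp, fun {F G} h => ?_, fun {F G H} h k => ?_⟩
    · have := congrArg (fun t => Expansion.can G.src F.src ≫ t ≫ Expansion.can G.tgt F.tgt) h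
      simpa using this.symm
    · rw [← Expansion.can_trans F.tgt G.tgt H.tgt, ← Category.assoc, h, Category.assoc, k,
        Expansion.can_trans_assoc]

/-- The morphisms `X → Y` of the coarse shape category of the pair `(C, P)`. -/
def CoarseHom (P : ObjectProperty C) (X Y : C) := Quotient (CoarseRep.setoid.{w} P X Y)

namespace CoarseHom

variable {P : ObjectProperty C}

/-- Composition `G ∘ F` of coarse shape morphisms, through representatives. -/
noncomputable def comp {X Y Z : C} (G : CoarseHom.{w} P Y Z) (F : CoarseHom.{w} P X Y) :
    CoarseHom.{w} P X Z :=
  Quotient.map₂ (fun (g : CoarseRep.{w} P Y Z) (f : CoarseRep.{w} P X Y) =>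
      (⟨f.src, g.tgt, f.hom ≫ Expansion.can f.tgt g.src ≫ g.hom⟩ : CoarseRep.{w} P X Z))
    (fun g g' hg f f' hf => by
      change g.hom ≫ Expansion.can g.tgt g'.tgt = Expansion.can g.src g'.src ≫ g'.hom at hg
      change f.hom ≫ Expansion.can f.tgt f'.tgt = Expansion.can f.src f'.src ≫ f'.hom at hf
      change (f.hom ≫ Expansion.can f.tgt g.src ≫ g.hom) ≫ Expansion.can g.tgt g'.tgt =
        Expansion.can f.src f'.src ≫ f'.hom ≫ Expansion.can f'.tgt g'.src ≫ g'.hom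
      rw [← Category.assoc (Expansion.can f.src f'.src), ← hf]
      simp [hg])
    G F

/-- The coarse shape morphism represented by a pro*-morphism between expansions. -/
def ofPro {X Y : C} (p : Expansion.{w} P X) (q : Expansion.{w} P Y) (f : p.sys ⟶ q.sys) :
    CoarseHom.{w} P X Y :=
  Quotient.mk (CoarseRep.setoid.{w} P X Y) ⟨p, q, f⟩

theorem comp_ofPro {X Y Z : C} (p : Expansion.{w} P X) (q : Expansion.{w} P Y)
    (r : Expansion.{w} P Z) (f : p.sys ⟶ q.sys) (g : q.sys ⟶ r.sys) :
    (ofPro q r g).comp (ofPro p q f) = ofPro p r (f ≫ g) := by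
  change ofPro p r (f ≫ Expansion.can q q ≫ g) = _
  simp

/-- Every coarse shape morphism is represented between any prescribed expansions. -/
theorem exists_ofPro {X Y : C} (F : CoarseHom.{w} P X Y) (p : Expansion.{w} P X)
    (q : Expansion.{w} P Y) : ∃ f, F = ofPro p q f := by
  obtain ⟨F⟩ := F
  refine ⟨Expansion.can p F.src ≫ F.hom ≫ Expansion.can F.tgt q, Quotient.sound ?_⟩
  change F.hom ≫ Expansion.can F.tgt q = Expansion.can F.src p ≫ _
  simp

theorem exists_expansions {X Y : C} (F : CoarseHom.{w} P X Y) :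
    Nonempty (Expansion.{w} P X) ∧ Nonempty (Expansion.{w} P Y) := by
  obtain ⟨F⟩ := F
  exact ⟨⟨F.src⟩, ⟨F.tgt⟩⟩

theorem comp_assoc {X Y Z W : C} (H : CoarseHom.{w} P Z W) (G : CoarseHom.{w} P Y Z)
    (F : CoarseHom.{w} P X Y) : (H.comp G).comp F = H.comp (G.comp F) := by
  obtain ⟨⟨p⟩, ⟨q⟩⟩ := F.exists_expansions
  obtain ⟨⟨r⟩, ⟨s⟩⟩ := H.exists_expansions
  obtain ⟨f, rfl⟩ := F.exists_ofPro p q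
  obtain ⟨g, rfl⟩ := G.exists_ofPro q r
  obtain ⟨h, rfl⟩ := H.exists_ofPro r s
  simp only [comp_ofPro, Category.assoc]

/-- The identity coarse shape morphism of `X`: the class of the identity of `p.sys` for an
expansion `p` of `X`. -/
def idOf {X : C} (p : Expansion.{w} P X) : CoarseHom.{w} P X X := ofPro p p (𝟙 p.sys)

/-- The identity does not depend on the expansion. -/
theorem idOf_eq {X : C} (p p' : Expansion.{w} P X) : idOf p = idOf p' := by
  refine Quotient.sound ?_
  change 𝟙 _ ≫ Expansion.can p p' = Expansion.can p p' ≫ 𝟙 _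
  simp

/-- `E` is the identity coarse shape morphism of `X`. -/
def IsId {X : C} (E : CoarseHom.{w} P X X) : Prop := ∃ p : Expansion.{w} P X, E = idOf p

/-- The coarse shape morphism `X → X_a` induced by the projection `p_a : X ⟶ X_a` of an
expansion. -/
def proj {X : C} (p : Expansion.{w} P X) (a : p.sys.Idx) : CoarseHom.{w} P X (p.sys.obj a) :=
  ofPro p (Expansion.rudimentary (p.sys.obj a) (p.mem a)) (SysMor.toPro
    { idx := fun _ => a
      hom := fun _ => 𝟙 (p.sys.obj a)
      comm := fun _ => ⟨a, le_rfl, le_rfl, congrArg _ (Category.id_comp _)⟩ })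

/-! ## The topology on the set of coarse shape morphisms -/

/-- The set `V_a^F` of all `G : Y → X` with `p_a ∘ F = p_a ∘ G`. -/
def V {X Y : C} (p : Expansion.{w} P X) (a : p.sys.Idx) (F : CoarseHom.{w} P Y X) :
    Set (CoarseHom.{w} P Y X) :=
  {G | (proj p a).comp F = (proj p a).comp G}

/-- The topology `T_p` generated by the sets `V_a^F`, for an expansion `p` of the target. -/
@[reducible] def topologyOf {X : C} (Y : C) (p : Expansion.{w} P X) : TopologicalSpace (CoarseHom.{w} P Y X) :=
  TopologicalSpace.generateFrom {U | ∃ a F, U = V p a F}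

/-- The topology on the set of coarse shape morphisms. It is equal to `topologyOf Y p` for every
expansion `p` of `X`, see `topology_eq`. -/
instance topology {X Y : C} : TopologicalSpace (CoarseHom.{w} P Y X) :=
  ⨅ p : Expansion.{w} P X, topologyOf Y p

theorem proj_comp_eq_iff {X Y : C} (p : Expansion.{w} P X) (a : p.sys.Idx) (s : Expansion.{w} P Y)
    (f g : SStarMor s.sys p.sys) :
    (proj p a).comp (ofPro s p f.toPro) = (proj p a).comp (ofPro s p g.toPro) ↔
      ∃ (l : s.sys.Idx) (h₁ : f.idx a ≤ l) (h₂ : g.idx a ≤ l) (n : ℕ), ∀ n' : ℕ, n ≤ n' →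
        s.sys.bond h₁ ≫ f.hom n' a = s.sys.bond h₂ ≫ g.hom n' a := by
  unfold proj
  rw [comp_ofPro, comp_ofPro]
  constructor
  · intro h
    have h' := Quotient.exact h
    change (_ ≫ _) ≫ Expansion.can _ _ = Expansion.can s s ≫ (_ ≫ _) at h'
    rw [Expansion.can_self, Expansion.can_self, Category.id_comp, Category.comp_id] at h'
    obtain ⟨l, h₁, h₂, n, e⟩ := Quotient.exact h' PUnit.unit
    refine ⟨l, h₁, h₂, n, fun n' hn => ?_⟩
    have e₁ := congrArg (fun t => s.sys.bond h₁ ≫ t) (Category.comp_id (f.hom n' a))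
    have e₂ := congrArg (fun t => s.sys.bond h₂ ≫ t) (Category.comp_id (g.hom n' a))
    exact e₁.symm.trans ((e n' hn).trans e₂)
  · rintro ⟨l, h₁, h₂, n, e⟩
    refine congrArg _ (Quotient.sound fun _ => ⟨l, h₁, h₂, n, fun n' hn => ?_⟩)
    have e₁ := congrArg (fun t => s.sys.bond h₁ ≫ t) (Category.comp_id (f.hom n' a))
    have e₂ := congrArg (fun t => s.sys.bond h₂ ≫ t) (Category.comp_id (g.hom n' a))
    exact e₁.trans ((e n' hn).trans e₂.symm)

theorem V_mono {X Y : C} (p : Expansion.{w} P X) {a b : p.sys.Idx} (h : a ≤ b)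
    (F : CoarseHom.{w} P Y X) : V p b F ⊆ V p a F := by
  intro G hG
  obtain ⟨⟨s⟩, -⟩ := F.exists_expansions
  obtain ⟨⟨f⟩, rfl⟩ := F.exists_ofPro s p
  obtain ⟨⟨g⟩, rfl⟩ := G.exists_ofPro s p
  obtain ⟨l, h₁, h₂, n, e⟩ := (proj_comp_eq_iff p b s f g).1 hG
  refine (proj_comp_eq_iff p a s f g).2 ?_
  obtain ⟨c, c₁, c₂, i, ec⟩ := f.comm h
  obtain ⟨d, d₁, d₂, j, ed⟩ := g.comm h
  obtain ⟨k, hk, hk'⟩ := exists_ge_ge c d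
  obtain ⟨L, hL, hL'⟩ := exists_ge_ge k l
  refine ⟨L, c₁.trans (hk.trans hL), d₁.trans (hk'.trans hL), max n (max i j), fun t ht => ?_⟩
  rw [← SStarMor.bond_congr (ec t (by omega)) (hk.trans hL),
    ← SStarMor.bond_congr (ed t (by omega)) (hk'.trans hL), ← Category.assoc, ← Category.assoc,
    SStarMor.bond_congr (e t (by omega)) hL']

theorem V_eq {X Y : C} {p : Expansion.{w} P X} {a : p.sys.Idx} {F G : CoarseHom.{w} P Y X}
    (h : G ∈ V p a F) : V p a G = V p a F := by
  ext H
  change _ = _ ↔ _ = _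
  change _ = _ at h
  rw [h]

/-- The sets `V_a^F` form a basis of `T_p`. -/
theorem isTopologicalBasis_V {X : C} (Y : C) (p : Expansion.{w} P X) :
    @TopologicalSpace.IsTopologicalBasis _ (topologyOf Y p) {U | ∃ a F, U = V p a F} := by
  let _ := topologyOf Y p
  refine ⟨?_, ?_, rfl⟩
  · rintro _ ⟨a, F, rfl⟩ _ ⟨b, G, rfl⟩ H ⟨hF, hG⟩
    obtain ⟨c, hac, hbc⟩ := exists_ge_ge a b
    refine ⟨_, ⟨c, H, rfl⟩, rfl, ?_⟩
    rw [← V_eq hF, ← V_eq hG]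
    exact Set.subset_inter (V_mono p hac H) (V_mono p hbc H)
  · refine Set.eq_univ_of_forall fun F => ?_
    obtain ⟨a⟩ := p.sys.nonempty
    exact ⟨_, ⟨a, F, rfl⟩, rfl⟩

theorem topologyOf_le {X : C} (Y : C) (p p' : Expansion.{w} P X) :
    topologyOf Y p ≤ topologyOf Y p' := by
  refine le_generateFrom ?_
  rintro _ ⟨m, F, rfl⟩
  rw [@TopologicalSpace.IsTopologicalBasis.isOpen_iff _ (topologyOf Y p) _ _
    (isTopologicalBasis_V Y p)]
  intro G hG
  rw [← V_eq hG]
  clear hG F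
  obtain ⟨i, hi⟩ := Expansion.exists_compat p p'
  refine ⟨_, ⟨i.idx m, G, rfl⟩, rfl, fun H hH => ?_⟩
  obtain ⟨⟨s⟩, -⟩ := G.exists_expansions
  have key : ∀ K : CoarseHom.{w} P Y X, ∃ k : SStarMor s.sys p.sys,
      K = ofPro s p k.toPro ∧ K = ofPro s p' (k.comp i.toStar).toPro := by
    intro K
    obtain ⟨⟨k⟩, rfl⟩ := K.exists_ofPro s p
    refine ⟨k, rfl, Quotient.sound ?_⟩
    change k.toPro ≫ Expansion.can p p' = Expansion.can s s ≫ (k.toPro ≫ i.toPro)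
    rw [Expansion.can_self, Expansion.can_eq hi, Category.id_comp]
  obtain ⟨g, hg, hg'⟩ := key G
  obtain ⟨k, hk, hk'⟩ := key H
  have h1 : (proj p (i.idx m)).comp G = (proj p (i.idx m)).comp H := hH
  rw [hg, hk] at h1
  obtain ⟨l, h₁, h₂, n, e⟩ := (proj_comp_eq_iff p _ s g k).1 h1
  change (proj p' m).comp G = (proj p' m).comp H
  rw [hg', hk']
  refine (proj_comp_eq_iff p' _ s _ _).2 ⟨l, h₁, h₂, n, fun n' hn => ?_⟩
  change s.sys.bond h₁ ≫ g.hom n' (i.idx m) ≫ i.hom m =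
    s.sys.bond h₂ ≫ k.hom n' (i.idx m) ≫ i.hom m
  rw [← Category.assoc, e n' hn, Category.assoc]

/-- The topology does not depend on the expansion of the target. -/
theorem topology_eq {X Y : C} (p : Expansion.{w} P X) :
    (topology : TopologicalSpace (CoarseHom.{w} P Y X)) = topologyOf Y p :=
  le_antisymm (iInf_le _ p) (le_iInf fun p' => topologyOf_le Y p p')

end CoarseHom

end ProStar

/-! ## The homotopy category of spaces and the homotopy category of polyhedra -/

section HPol

universe u

/-- Objects of the homotopy category of topological spaces. -/
structure HTop where
  carrier : Type u
  [top : TopologicalSpace carrier]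

attribute [instance] HTop.top

/-- The homotopy relation on continuous maps. -/
def homotopySetoid (X Y : Type u) [TopologicalSpace X] [TopologicalSpace Y] : Setoid C(X, Y) where
  r := ContinuousMap.Homotopic
  iseqv := ContinuousMap.Homotopic.equivalence

/-- The homotopy category: morphisms are homotopy classes of continuous maps. -/
instance HTop.category : Category.{u} HTop.{u} where
  Hom X Y := Quotient (homotopySetoid X.carrier Y.carrier)
  id X := Quotient.mk (homotopySetoid X.carrier X.carrier) (ContinuousMap.id X.carrier)
  comp := Quotient.map₂ (fun f g => g.comp f) fun _ _ hf _ _ hg =>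
    ContinuousMap.Homotopic.comp hg hf
  id_comp := by rintro X Y ⟨f⟩; rfl
  comp_id := by rintro X Y ⟨f⟩; rfl
  assoc := by rintro X Y Z W ⟨f⟩ ⟨g⟩ ⟨h⟩; rfl

variable {W : Type u}

/-- The closed simplex spanned by the finite set `s`, in barycentric coordinates; it carries the
subspace topology, which is the Euclidean one since only the coordinates in `s` are nonzero. -/
def closedSimplex (s : Finset W) : Set (W → ℝ) :=
  {t | (∀ v, 0 ≤ t v) ∧ (∀ v, v ∉ s → t v = 0) ∧ ∑ v ∈ s, t v = 1}

/-- The polyhedron `|K|` of an abstract simplicial complex. -/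
def Polyhedron (K : AbstractSimplicialComplex W) : Type u :=
  {t : W → ℝ // ∃ s ∈ K.faces, t ∈ closedSimplex s}

/-- The inclusion of a closed simplex of `K`. -/
def Polyhedron.incl (K : AbstractSimplicialComplex W) (s : K.faces) (t : closedSimplex s.1) :
    Polyhedron K :=
  ⟨t.1, s.1, s.2, t.2⟩

/-- The weak topology: a set is open iff its trace on every closed simplex is open. -/
instance Polyhedron.topology (K : AbstractSimplicialComplex W) : TopologicalSpace (Polyhedron K) :=
  ⨆ s : K.faces, TopologicalSpace.coinduced (Polyhedron.incl K s) inferInstance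

/-- The objects of HPol: the spaces having the homotopy type of a polyhedron. -/
def HPol : ObjectProperty HTop.{u} := fun X =>
  ∃ (W : Type u) (K : AbstractSimplicialComplex W),
    Nonempty (ContinuousMap.HomotopyEquiv X.carrier (Polyhedron K))

end HPol

/-! ## Coarse shape of topological spaces -/

section ShStar

universe u

/-- The set `Sh*(X, Y)` of coarse shape morphisms between topological spaces, with its
topology. -/
abbrev ShStar (X Y : Type u) [TopologicalSpace X] [TopologicalSpace Y] : Type (u + 1) :=
  CoarseHom.{u} HPol.{u} ⟨X⟩ ⟨Y⟩

namespace ShStar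

variable {X Y : Type u} [TopologicalSpace X] [TopologicalSpace Y]

/-- `F₁ : Sh*(Y, Z) → Sh*(X, Z)`, `H ↦ H ∘ F`. -/
noncomputable def precomp (F : ShStar X Y) (Z : Type u) [TopologicalSpace Z] (H : ShStar Y Z) :
    ShStar X Z := H.comp F

/-- `F₂ : Sh*(Z, X) → Sh*(Z, Y)`, `G ↦ F ∘ G`. -/
noncomputable def postcomp (F : ShStar X Y) (Z : Type u) [TopologicalSpace Z] (G : ShStar Z X) :
    ShStar Z Y := F.comp G

/-- `Sh*(X) ≥ Sh*(Y)`: the space `X` dominates `Y` in coarse shape. -/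
def Dominates (X Y : Type u) [TopologicalSpace X] [TopologicalSpace Y] : Prop :=
  ∃ (F : ShStar X Y) (G : ShStar Y X), (F.comp G).IsId

/-- `Sh*(X) = Sh*(Y)`: the spaces are isomorphic in the coarse shape category. -/
def SameShape (X Y : Type u) [TopologicalSpace X] [TopologicalSpace Y] : Prop :=
  ∃ (F : ShStar X Y) (G : ShStar Y X), (F.comp G).IsId ∧ (G.comp F).IsId

end ShStar

/-- The subspace `A` is a retract of `S`. -/
def IsRetractSet {S : Type*} [TopologicalSpace S] (A : Set S) : Prop :=
  ∃ r : C(S, A), ∀ a : A, r a = a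

/-- `T` is homeomorphic to a retract of `S`. -/
def HomeoToRetract (T S : Type*) [TopologicalSpace T] [TopologicalSpace S] : Prop :=
  ∃ A : Set S, IsRetractSet A ∧ Nonempty (T ≃ₜ A)

end ShStar

universe u

/-! Continuity rests on a factorization. If an $S^*$-morphism $(f,f^n_\mu)$ represents $G$ between
expansions $(p_\lambda)$ of its source and $(q_\mu)$ of its target, then $q_\mu\circ G$ depends only
on the sequence $(f^n_\mu)_n$ at the single index $f(\mu)$. Hence $q_\mu\circ G=g\circ p_{f(\mu)}$
for a coarse shape morphism $g$ between terms of the two systems (`CoarseHom.exists_proj_comp_eq`).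

Now take $F:X\to Y$, $G:Y\to Z$, expansions $(q_b)$ of $Y$ and $(r_c)$ of $Z$, and write $r_c\circ
G=g\circ q_b$. If $q_b F'=q_b F$ and $r_c G'=r_c G$, then $r_cG'F'=r_cGF'=g\,q_bF'=g\,q_bF=r_cGF$.
So $V^F_b\times V^G_c$ is mapped into $V^{GF}_c$, which gives `CoarseHom.continuous_comp`.

The rest is formal. Fixing one argument of the composition map gives continuity of $F_1$ and $F_2$,
and associativity gives functoriality. From $F\circ G=1^*_Y$ follow $G_1F_1=\mathrm{id}$ and
$F_2G_2=\mathrm{id}$, so $F_1$ and $G_2$ are sections with continuous left inverses. When $G\circ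
F=1^*_X$ as well, they are homeomorphisms. -/

section CoarseShapeCategory

universe w v

attribute [local instance 2000] CategoryStruct.toQuiver

/-! ### Identity laws, factorization through projections, and continuity of composition. -/

namespace CoarseHom

variable {C : Type u} [Category.{v} C] {P : ObjectProperty C} {X Y Z : C}

/-- Any morphism can be represented with the target expansion that exhibits `E` as an identity, so
this is the identity law of the pro*-category. -/
theorem IsId.comp_left {E : CoarseHom.{w} P Y Y} (hE : E.IsId) (F : CoarseHom.{w} P X Y) :
    E.comp F = F := by
  obtain ⟨q, rfl⟩ := hE
  obtain ⟨⟨p⟩, -⟩ := F.exists_expansions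
  obtain ⟨f, rfl⟩ := F.exists_ofPro p q
  rw [idOf, comp_ofPro, Category.comp_id]

theorem IsId.comp_right {E : CoarseHom.{w} P X X} (hE : E.IsId) (F : CoarseHom.{w} P X Y) :
    F.comp E = F := by
  obtain ⟨p, rfl⟩ := hE
  obtain ⟨-, ⟨q⟩⟩ := F.exists_expansions
  obtain ⟨f, rfl⟩ := F.exists_ofPro p q
  rw [idOf, comp_ofPro, Category.id_comp]

/-- The composite of a coarse shape morphism with a projection of an expansion of its target
factors through a projection of any given expansion of its source. -/
theorem exists_proj_comp_eq (G : CoarseHom.{w} P X Y) (p : Expansion.{w} P X)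
    (q : Expansion.{w} P Y) (b : q.sys.Idx) :
    ∃ (a : p.sys.Idx) (g : CoarseHom.{w} P (p.sys.obj a) (q.sys.obj b)),
      (proj q b).comp G = g.comp (proj p a) := by
  obtain ⟨⟨f⟩, rfl⟩ := G.exists_ofPro p q
  -- The sequence $(f^n_b)_n$ may vary with $n$, so it need not come from one morphism of `C`.
  -- Between one-term systems the commutation condition is vacuous, hence every sequence is an
  -- $S^*$-morphism.
  let φ : SStarMor (InvSystem.rudimentary.{w} (p.sys.obj (f.idx b)))
      (InvSystem.rudimentary.{w} (q.sys.obj b)) :=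
    { idx := fun _ => PUnit.unit
      hom := fun n _ => f.hom n b
      comm := fun _ => ⟨PUnit.unit, le_rfl, le_rfl, 0, fun n _ =>
        congrArg _ (Category.comp_id (f.hom n b))⟩ }
  refine ⟨f.idx b, ofPro (Expansion.rudimentary _ (p.mem _)) (Expansion.rudimentary _ (q.mem b))
    φ.toPro, ?_⟩
  refine (comp_ofPro p q _ f.toPro _).trans (Eq.trans ?_
    (comp_ofPro p (Expansion.rudimentary _ (p.mem (f.idx b)))
      (Expansion.rudimentary _ (q.mem b)) _ φ.toPro).symm)
  -- Up to identities both composites are $f^n_b$ at the index $f(b)$, for every $n$.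
  refine congrArg _ (Quotient.sound fun _ => ⟨f.idx b, le_rfl, le_rfl, 0, fun n _ => ?_⟩)
  exact congrArg (fun t => p.sys.bond le_rfl ≫ t)
    ((Category.comp_id (f.hom n b)).trans (Category.id_comp (f.hom n b)).symm)

theorem isOpen_V (p : Expansion.{w} P Y) (a : p.sys.Idx) (F : CoarseHom.{w} P X Y) :
    IsOpen (V p a F) := by
  have h : @IsOpen _ (topologyOf X p) (V p a F) := .basic _ ⟨a, F, rfl⟩
  rwa [← topology_eq p] at h

theorem continuous_comp :
    Continuous fun FG : CoarseHom.{w} P X Y × CoarseHom.{w} P Y Z => FG.2.comp FG.1 := by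
  -- The point serves only to supply expansions of $Y$ and $Z$, carried by the representative of
  -- `G`. After that, continuity is proved globally on the basic open sets for `r`.
  refine continuous_iff_continuousAt.2 fun ⟨F, G⟩ => ?_
  obtain ⟨⟨q⟩, ⟨r⟩⟩ := G.exists_expansions
  suffices h : @Continuous _ _ _ (topologyOf X r)
      fun FG : CoarseHom.{w} P X Y × CoarseHom.{w} P Y Z => FG.2.comp FG.1 by
    rw [← topology_eq r] at h
    exact h.continuousAt
  refine continuous_generateFrom_iff.2 ?_
  rintro _ ⟨c, H, rfl⟩
  refine isOpen_iff_mem_nhds.2 fun ⟨F, G⟩ hFG => ?_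
  obtain ⟨b, g, hg⟩ := G.exists_proj_comp_eq q r c
  -- The index `b` depends on `G` through the factorization `hg`. Keeping $r_c\circ G$ fixed lets
  -- the same `g` serve for every nearby `G'`.
  filter_upwards [prod_mem_nhds ((isOpen_V q b F).mem_nhds rfl) ((isOpen_V r c G).mem_nhds rfl)]
    with ⟨F', G'⟩ ⟨hF, hG⟩
  change (proj q b).comp F = (proj q b).comp F' at hF
  change (proj r c).comp G = (proj r c).comp G' at hG
  change (proj r c).comp H = (proj r c).comp (G.comp F) at hFG
  change (proj r c).comp H = (proj r c).comp (G'.comp F')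
  rw [hFG, ← comp_assoc, ← comp_assoc, ← hG, hg, comp_assoc, comp_assoc, hF]

end CoarseHom

end CoarseShapeCategory

/-! ### Retracts from continuous left inverses. -/

/-- A space `T` which admits a section-retraction pair into `S` is homeomorphic to a retract
of `S`. -/
theorem HomeoToRetract.of_leftInverse {T S : Type*} [TopologicalSpace T] [TopologicalSpace S]
    {i : T → S} {r : S → T} (hi : Continuous i) (hr : Continuous r)
    (h : Function.LeftInverse r i) : HomeoToRetract T S := by
  -- The retraction onto the image is $i\circ r$, and $i$ is an embedding because it has a
  -- continuous left inverse.
  refine ⟨Set.range i, ⟨⟨fun s => ⟨i (r s), r s, rfl⟩, by fun_prop⟩, ?_⟩,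
    ⟨(Topology.IsEmbedding.of_leftInverse h hr hi).toHomeomorph⟩⟩
  rintro ⟨_, t, rfl⟩
  exact Subtype.ext (congrArg i (h t))

/-! ### The induced maps $F_1$ and $F_2$. -/

namespace ShStar

variable {X Y : Type u} [TopologicalSpace X] [TopologicalSpace Y]

theorem continuous_precomp (F : ShStar X Y) (Z : Type u) [TopologicalSpace Z] :
    Continuous (precomp F Z) :=
  CoarseHom.continuous_comp.comp (Continuous.prodMk_right F)

theorem continuous_postcomp (F : ShStar X Y) (Z : Type u) [TopologicalSpace Z] :
    Continuous (postcomp F Z) :=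
  CoarseHom.continuous_comp.comp (Continuous.prodMk_left F)

/-- Contravariance: $G_1F_1=(F\circ G)_1$. In the covariant counterpart below, $F_2G_2=(F\circ
G)_2$, so there the section is induced by `G` instead of `F`. -/
theorem leftInverse_precomp {F : ShStar X Y} {G : ShStar Y X} (h : (F.comp G).IsId)
    (Z : Type u) [TopologicalSpace Z] : Function.LeftInverse (precomp G Z) (precomp F Z) :=
  fun H => (CoarseHom.comp_assoc H F G).trans (h.comp_right H)

theorem leftInverse_postcomp {F : ShStar X Y} {G : ShStar Y X} (h : (F.comp G).IsId)
    (Z : Type u) [TopologicalSpace Z] : Function.LeftInverse (postcomp F Z) (postcomp G Z) :=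
  fun H => (CoarseHom.comp_assoc F G H).symm.trans (h.comp_left H)

end ShStar

theorem theorem3p3 (X Y Z : Type u)
    [TopologicalSpace X] [TopologicalSpace Y] [TopologicalSpace Z] :
    -- the composition map is continuous
    Continuous (fun FG : ShStar X Y × ShStar Y Z => FG.2.comp FG.1) ∧
    -- (i) precomposition and postcomposition are continuous and functorial
    (∀ F : ShStar X Y,
      Continuous (ShStar.precomp F Z) ∧ Continuous (ShStar.postcomp F Z)) ∧
    (∀ (W : Type u) [TopologicalSpace W] (F : ShStar X Y) (G : ShStar Y W),
      ShStar.postcomp (G.comp F) Z = ShStar.postcomp G Z ∘ ShStar.postcomp F Z ∧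
      ShStar.precomp (G.comp F) Z = ShStar.precomp F Z ∘ ShStar.precomp G Z) ∧
    (∀ E : ShStar X X, E.IsId →
      ShStar.precomp E Z = id ∧ ShStar.postcomp E Z = id) ∧
    -- (ii) coarse shape domination gives retracts
    (ShStar.Dominates X Y →
      HomeoToRetract (ShStar Y Z) (ShStar X Z) ∧ HomeoToRetract (ShStar Z Y) (ShStar Z X)) ∧
    -- (iii) equality of coarse shapes gives homeomorphisms
    (ShStar.SameShape X Y →
      Nonempty (ShStar Y Z ≃ₜ ShStar X Z) ∧ Nonempty (ShStar Z Y ≃ₜ ShStar Z X)) := by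
  refine ⟨CoarseHom.continuous_comp,
    fun F => ⟨F.continuous_precomp Z, F.continuous_postcomp Z⟩,
    fun W _ F G => ⟨funext fun H => CoarseHom.comp_assoc G F H,
      funext fun H => (CoarseHom.comp_assoc H G F).symm⟩,
    fun E hE => ⟨funext hE.comp_right, funext hE.comp_left⟩, ?_, ?_⟩
  · rintro ⟨F, G, h⟩
    exact ⟨.of_leftInverse (F.continuous_precomp Z) (G.continuous_precomp Z)
        (ShStar.leftInverse_precomp h Z),
      .of_leftInverse (G.continuous_postcomp Z) (F.continuous_postcomp Z)
        (ShStar.leftInverse_postcomp h Z)⟩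
  · rintro ⟨F, G, h, h'⟩
    -- The second identity `h'` supplies the other one-sided inverse, with the roles of `F` and `G`
    -- exchanged.
    exact ⟨⟨{ toFun := ShStar.precomp F Z
              invFun := ShStar.precomp G Z
              left_inv := ShStar.leftInverse_precomp h Z
              right_inv := ShStar.leftInverse_precomp h' Z
              continuous_toFun := ShStar.continuous_precomp F Z
              continuous_invFun := ShStar.continuous_precomp G Z }⟩,
      ⟨{ toFun := ShStar.postcomp G Z
         invFun := ShStar.postcomp F Z
         left_inv := ShStar.leftInverse_postcomp h Z
         right_inv := ShStar.leftInverse_postcomp h' Z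
         continuous_toFun := ShStar.continuous_postcomp G Z
         continuous_invFun := ShStar.continuous_postcomp F Z }⟩⟩
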